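/- Let $\mathcal C$ be an equational class of (non-empty, finitary) algebras of the same type, let $A$ be an algebra in $\mathcal C$, and let $\mathrm{Con}(A)$ be its complete lattice of congruences, with least element $\Delta_A$ (equality) and greatest element $\nabla_A=A^2$. The class $\mathcal C$ is called congruence-distributive (congruence-modular) if the congruence lattice of every algebra in $\mathcal C$ is distributive (modular). For $\alpha,\beta\in\mathrm{Con}(A)$, the commutator $[\alpha,\beta]_A$ is the least $\delta\in\mathrm{Con}(A)$ such that, for all $m,n\ge 0$, every $(m+n)$-ary term $t$, all $a,b\in A^m$ with $a_i\mathrel{\alpha}b_i$ for all $i$ and all $c,d\in A^n$ with $c_j\mathrel{\beta}d_j$ for all $j$: if $t(a,c)\mathrel{\delta}t(a,d)$, then $t(b,c)\mathrel{\delta}t(b,d)$. A congruence $\phi$ of $A$ is called * proper if $\phi\neq\nabla_A$; * prime if it is proper and, for all $\alpha,\beta\in\mathrm{Con}(A)$, $[\alpha,\beta]_A\subseteq\phi$ implies $\alpha\subseteq\phi$ or $\beta\subseteq\phi$; * meet-irreducible if, for all $\alpha,\beta\in\mathrm{Con}(A)$, $\phi=\alpha\cap\beta$ implies $\phi=\alpha$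 or $\phi=\beta$; * strictly meet-irreducible if the set $\{\psi\in\mathrm{Con}(A)\mid\phi\subsetneq\psi\}$ has a minimum. Assume that $\mathcal C$ is congruence-distributive, or that $\mathcal C$ is congruence-modular and $[\alpha,\beta]_A=\alpha\cap\beta$ for all $\alpha,\beta\in\mathrm{Con}(A)$. Let $\phi\in\mathrm{Con}(A)$. Then: 1. if $\phi$ is strictly meet-irreducible, then $\phi$ is prime; 2. if $\phi$ is prime, then $\phi$ is proper and meet-irreducible; 3. if the filter $[\phi)=\{\psi\in\mathrm{Con}(A)\mid\phi\subseteq\psi\}$ is finite, then: $\phi$ is prime if and only if $\phi$ is strictly meet-irreducible, if and only if $\phi$ is proper and meet-irreducible; 4. if $\mathrm{Con}(A)$ is finite, then: $\phi$ is prime if and only if $\phi$ is strictly meet-irreducible, if and only if $\phi$ is proper and meet-irreducible. -/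

import Mathlib

/- Algebras of a fixed (finitary) type are structures over a first-order language `L` without
relation symbols (`L.IsAlgebraic`); the operation symbols of arity `n` are `L.Functions n`. -/

universe u v w

namespace UniversalAlgebra

/-- A congruence of the algebra `M`: an equivalence relation compatible with all operations. -/
@[ext]
structure Congruence (L : FirstOrder.Language.{u, v}) (M : Type w) [L.Structure M]
    extends Setoid M where
  map_fun : ∀ {n : ℕ} (f : L.Functions n) (x y : Fin n → M), (∀ i, r (x i) (y i)) →
    r (FirstOrder.Language.Structure.funMap f x) (FirstOrder.Language.Structure.funMap f y)

namespace Congruence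

variable {L : FirstOrder.Language.{u, v}} {M : Type w} [L.Structure M]

theorem toSetoid_injective :
    Function.Injective (toSetoid : Congruence L M → Setoid M) := by
  rintro ⟨s, hs⟩ ⟨t, ht⟩ h
  cases h
  rfl

/-- Congruences are ordered by inclusion: `φ ≤ ψ` iff `φ x y` implies `ψ x y`. -/
instance : PartialOrder (Congruence L M) := PartialOrder.lift toSetoid toSetoid_injective

theorem le_iff {φ ψ : Congruence L M} : φ ≤ ψ ↔ ∀ x y, φ.r x y → ψ.r x y :=
  ⟨fun h x y hxy => h hxy, fun h x y hxy => h x y hxy⟩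

/-- The intersection of a set of congruences. -/
instance : InfSet (Congruence L M) where
  sInf S :=
    { r := fun x y => ∀ φ ∈ S, φ.r x y
      iseqv := ⟨fun x φ _ => φ.iseqv.refl x, fun h φ hφ => φ.iseqv.symm (h φ hφ),
        fun h k φ hφ => φ.iseqv.trans (h φ hφ) (k φ hφ)⟩
      map_fun := fun f x y h φ hφ => φ.map_fun f x y fun i => h i φ hφ }

theorem isGLB_sInf (S : Set (Congruence L M)) : IsGLB S (sInf S) :=
  ⟨fun φ hφ => le_iff.2 fun _ _ h => h φ hφ,
    fun _ hψ => le_iff.2 fun x y h φ hφ => le_iff.1 (hψ hφ) x y h⟩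

/-- The complete lattice `Con(M)`: meets are intersections, `⊤` is the total relation, `⊥` is
equality, and the join of a set of congruences is the least congruence containing all of them. -/
instance : CompleteLattice (Congruence L M) where
  __ := completeLatticeOfInf (Congruence L M) isGLB_sInf
  inf φ ψ :=
    { r := fun x y => φ.r x y ∧ ψ.r x y
      iseqv := ⟨fun x => ⟨φ.iseqv.refl x, ψ.iseqv.refl x⟩,
        fun h => ⟨φ.iseqv.symm h.1, ψ.iseqv.symm h.2⟩,
        fun h k => ⟨φ.iseqv.trans h.1 k.1, ψ.iseqv.trans h.2 k.2⟩⟩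
      map_fun := fun f x y h =>
        ⟨φ.map_fun f x y fun i => (h i).1, ψ.map_fun f x y fun i => (h i).2⟩ }
  inf_le_left _ _ := le_iff.2 fun _ _ h => h.1
  inf_le_right _ _ := le_iff.2 fun _ _ h => h.2
  le_inf _ _ _ h k := le_iff.2 fun x y hxy => ⟨le_iff.1 h x y hxy, le_iff.1 k x y hxy⟩
  top :=
    { r := fun _ _ => True
      iseqv := ⟨fun _ => trivial, fun _ => trivial, fun _ _ => trivial⟩
      map_fun := fun _ _ _ _ => trivial }
  le_top _ := le_iff.2 fun _ _ _ => trivial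
  bot :=
    { r := fun x y => x = y
      iseqv := ⟨fun _ => rfl, fun h => h.symm, fun h k => h.trans k⟩
      map_fun := fun f x y h => congrArg _ (funext h) }
  bot_le φ := le_iff.2 fun x y h => by
    have h' : x = y := h
    subst h'
    exact φ.iseqv.refl x

/-- `α` centralizes `β` modulo `δ` (the term condition `C(α, β; δ)`): for every term `t(x, y)` in
two tuples of variables and all tuples `a α b`, `c β d`, if `t(a, c) δ t(a, d)` then
`t(b, c) δ t(b, d)`. -/
def Centralizes (α β δ : Congruence L M) : Prop :=
  ∀ (m n : ℕ) (t : L.Term (Fin m ⊕ Fin n)) (a b : Fin m → M) (c d : Fin n → M),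
    (∀ i, α.r (a i) (b i)) → (∀ j, β.r (c j) (d j)) →
    δ.r (t.realize (Sum.elim a c)) (t.realize (Sum.elim a d)) →
    δ.r (t.realize (Sum.elim b c)) (t.realize (Sum.elim b d))

/-- The commutator `[α, β]`: the least congruence `δ` such that `α` centralizes `β` modulo `δ`
(see `isLeast_commutator`). -/
def commutator (α β : Congruence L M) : Congruence L M :=
  sInf {δ | Centralizes α β δ}

theorem isLeast_commutator (α β : Congruence L M) :
    IsLeast {δ | Centralizes α β δ} (commutator α β) :=
  ⟨fun m n t a b c d hab hcd h δ hδ => hδ m n t a b c d hab hcd (h δ hδ),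
    (isGLB_sInf _).1⟩

/-- Prime congruences: proper congruences `φ` such that `[α, β] ⊆ φ` implies `α ⊆ φ` or
`β ⊆ φ`. -/
def IsPrime (φ : Congruence L M) : Prop :=
  φ ≠ ⊤ ∧ ∀ α β : Congruence L M, commutator α β ≤ φ → α ≤ φ ∨ β ≤ φ

end Congruence

/-- `M` belongs to the equational class defined by the set `E` of identities: it is a nonempty
algebra in which all identities `p.1 ≈ p.2`, `p ∈ E`, hold. -/
def MemEqClass {L : FirstOrder.Language.{u, v}} (E : Set (L.Term ℕ × L.Term ℕ))
    (M : Type w) [L.Structure M] : Prop :=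
  Nonempty M ∧ ∀ p ∈ E, ∀ x : ℕ → M, p.1.realize x = p.2.realize x

/-- The equational class defined by `E` is congruence-modular. -/
def IsCongruenceModular {L : FirstOrder.Language.{u, v}} (E : Set (L.Term ℕ × L.Term ℕ)) : Prop :=
  ∀ (M : Type w) [L.Structure M], MemEqClass E M → IsModularLattice (Congruence L M)

/-- The equational class defined by `E` is congruence-distributive. -/
def IsCongruenceDistributive {L : FirstOrder.Language.{u, v}} (E : Set (L.Term ℕ × L.Term ℕ)) :
    Prop :=
  ∀ (M : Type w) [L.Structure M], MemEqClass E M →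
    ∀ α β γ : Congruence L M, α ⊓ (β ⊔ γ) = (α ⊓ β) ⊔ (α ⊓ γ)

/-- `x` is meet-irreducible (the top element is allowed). -/
def MeetIrreducible {K : Type w} [Lattice K] (x : K) : Prop :=
  ∀ a b : K, x = a ⊓ b → x = a ∨ x = b

/-- `x` is strictly meet-irreducible: `{y | x < y}` has a minimum. -/
def StrictlyMeetIrreducible {K : Type w} [Lattice K] (x : K) : Prop :=
  ∃ y : K, IsLeast {y | x < y} y

end UniversalAlgebra

namespace UniversalAlgebra

open FirstOrder.Language Relation

/-! Under either assumption `Con(A)` is modular and commutators are intersections. Congruence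
distributivity yields the latter by applying distributivity in a three-generated subalgebra of `A ^
4` (`commutator_eq_inf_of_isCongruenceDistributive`). If `[α, β] = α ⊓ β`, then closure of
centralizers under joins makes `Con(A)` meet-semidistributive; with modularity, `α ⊓ β ≤ φ` forces
`(φ ⊔ α) ⊓ (φ ⊔ β) = φ` (`sup_inf_sup_eq_of_inf_le`). Hence a proper meet-irreducible `φ` is prime.
The rest is lattice theory. -/

/-- A property of tuples that is preserved by changing one entry along `R` is preserved by
changing all entries along the reflexive transitive closure of `R`. -/
theorem of_forall_reflTransGen {M : Type w} {n : ℕ} {R : M → M → Prop}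
    {P : (Fin n → M) → Prop}
    (step : ∀ (z : Fin n → M) (i : Fin n) (b : M), R (z i) b → P z → P (Function.update z i b))
    {a b : Fin n → M} (h : ∀ i, ReflTransGen R (a i) (b i)) (ha : P a) : P b := by
  have single : ∀ (z : Fin n → M) (i : Fin n) (y : M), ReflTransGen R (z i) y → P z →
      P (Function.update z i y) := by
    intro z i y hy hz
    induction hy with
    | refl => simpa using hz
    | @tail y w _ hyw ih =>
      simpa using step (Function.update z i y) i w (by simpa using hyw) ih
  have key : ∀ s : Finset (Fin n), P (s.piecewise b a) := by
    intro s
    induction s using Finset.induction_on with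
    | empty => simpa using ha
    | insert j s hj ih =>
      rw [Finset.piecewise_insert]
      exact single _ _ _ (by simpa [hj] using h j) ih
  simpa only [Finset.piecewise_univ] using key Finset.univ

/-! ### Joins of congruences and the term condition -/

namespace Congruence

variable {L : FirstOrder.Language.{u, v}} {M : Type w} [L.Structure M]

theorem r_update (α : Congruence L M) {n : ℕ} {z : Fin n → M} {i : Fin n} {b : M}
    (h : α.r (z i) b) (j : Fin n) : α.r (z j) (Function.update z i b j) := by
  by_cases hj : j = i
  · subst hj
    simpa using h
  · simp [hj]

theorem r_realize (α : Congruence L M) {κ : Type*} (t : L.Term κ) {a b : κ → M}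
    (h : ∀ i, α.r (a i) (b i)) : α.r (t.realize a) (t.realize b) := by
  induction t with
  | var i => exact h i
  | func f ts ih => exact α.map_fun f _ _ ih

/-- Related elements of a join are connected by a finite chain. -/
theorem reflTransGen_of_sup {α β : Congruence L M} {x y : M} (h : (α ⊔ β).r x y) :
    ReflTransGen (fun x y => α.r x y ∨ β.r x y) x y := by
  let ρ : Congruence L M :=
    { r := ReflTransGen (fun x y => α.r x y ∨ β.r x y)
      iseqv := ⟨fun _ => .refl, fun h => ReflTransGen.mono
        (fun _ _ h => h.imp α.iseqv.symm β.iseqv.symm) _ _ h.swap, fun h k => h.trans k⟩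
      map_fun := fun f x y h => by
        refine of_forall_reflTransGen
          (P := fun z => ReflTransGen (fun x y => α.r x y ∨ β.r x y)
            (FirstOrder.Language.Structure.funMap f x)
            (FirstOrder.Language.Structure.funMap f z)) ?_ h .refl
        intro z i b hb hz
        exact hz.tail (hb.imp (fun hb => α.map_fun f _ _ (α.r_update hb))
          fun hb => β.map_fun f _ _ (β.r_update hb)) }
  have hρ : α ⊔ β ≤ ρ := sup_le (le_iff.2 fun _ _ h => .single (.inl h))
    (le_iff.2 fun _ _ h => .single (.inr h))
  exact le_iff.1 hρ x y h

/-- With `c` and `d` fixed, the term condition transports one property of the left tuple along `α`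
and along `γ`, hence along chains of both. -/
theorem centralizes_sup {α γ β δ : Congruence L M} (hα : Centralizes α β δ)
    (hγ : Centralizes γ β δ) : Centralizes (α ⊔ γ) β δ := by
  intro m n t a b c d hab hcd h
  refine of_forall_reflTransGen
    (P := fun z => δ.r (t.realize (Sum.elim z c)) (t.realize (Sum.elim z d))) ?_
    (fun i => reflTransGen_of_sup (hab i)) h
  rintro z i e (he | he) hz
  · exact hα m n t _ _ c d (α.r_update he) hcd hz
  · exact hγ m n t _ _ c d (γ.r_update he) hcd hz

theorem commutator_le_inf (α β : Congruence L M) : commutator α β ≤ α ⊓ β := by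
  refine (isLeast_commutator α β).2 fun m n t a b c d hab hcd h => ⟨?_, ?_⟩
  · have key : ∀ e : Fin n → M,
        α.r (t.realize (Sum.elim a e)) (t.realize (Sum.elim b e)) := fun e =>
      -- The `α` half goes around the square: `t(b, c)`, `t(a, c)`, `t(a, d)`, `t(b, d)`.
      α.r_realize t (by rintro (i | j); exacts [hab i, α.iseqv.refl _])
    exact α.iseqv.trans (α.iseqv.symm (key c)) (α.iseqv.trans h.1 (key d))
  · exact β.r_realize t (by rintro (i | j); exacts [β.iseqv.refl _, hcd j])

end Congruence

/-! ### Subalgebras of powers -/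

section EvaluationAlgebra

variable {L : FirstOrder.Language.{u, v}} {M : Type w} [L.Structure M] {ι κ : Type}

/-- The subalgebra of `M ^ ι` generated by the `κ`-indexed family with coordinates `v`, described
as the set of values of terms. -/
def EvaluationAlgebra (L : FirstOrder.Language.{u, v}) {M : Type w} [L.Structure M] {ι κ : Type}
    (v : ι → κ → M) : Type w :=
  {p : ι → M // ∃ t : L.Term κ, ∀ i, p i = t.realize (v i)}

namespace EvaluationAlgebra

variable {v : ι → κ → M}

/-- The generator of index `k`. -/
def gen (v : ι → κ → M) (k : κ) : EvaluationAlgebra L v :=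
  ⟨fun i => v i k, .var k, fun _ => rfl⟩

instance [L.IsAlgebraic] : L.Structure (EvaluationAlgebra L v) where
  funMap f x := ⟨fun i => FirstOrder.Language.Structure.funMap f fun j => (x j).1 i,
    .func f fun j => (x j).2.choose, fun i =>
      congrArg _ (funext fun j => (x j).2.choose_spec i)⟩
  RelMap r := isEmptyElim r

variable [L.IsAlgebraic]

theorem realize_val {σ : Type*} (t : L.Term σ) (x : σ → EvaluationAlgebra L v) (i : ι) :
    (t.realize x).1 i = t.realize fun s => (x s).1 i := by
  induction t with
  | var s => rfl
  | func f ts ih => exact congrArg (FirstOrder.Language.Structure.funMap f) (funext ih)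

theorem memEqClass [Nonempty κ] {E : Set (L.Term ℕ × L.Term ℕ)} (hM : MemEqClass E M) :
    MemEqClass E (EvaluationAlgebra L v) :=
  ⟨‹Nonempty κ›.map (gen v), fun p hp x => Subtype.ext (funext fun i => by
    rw [realize_val, realize_val, hM.2 p hp])⟩

/-- The congruence of elements agreeing in all coordinates in `s`. -/
def ker (v : ι → κ → M) (s : Set ι) : Congruence L (EvaluationAlgebra L v) where
  r p q := ∀ i ∈ s, p.1 i = q.1 i
  iseqv := ⟨fun _ _ _ => rfl, fun h i hi => (h i hi).symm,
    fun h k i hi => (h i hi).trans (k i hi)⟩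
  map_fun f _ _ h i hi :=
    congrArg (FirstOrder.Language.Structure.funMap f) (funext fun j => h j i hi)

end EvaluationAlgebra

end EvaluationAlgebra

namespace Congruence

variable {L : FirstOrder.Language.{u, v}} {M : Type w} [L.Structure M]

-- Elements of the subalgebra are the squares `t(a, c), t(a, d), t(b, c), t(b, d)` of the term
-- condition. Distributivity replaces the path `X, Y, Z` by one whose members all agree with `X` in
-- the first two coordinates, where the term condition applies.
open EvaluationAlgebra in
theorem commutator_eq_inf_of_isCongruenceDistributive [L.IsAlgebraic]
    {E : Set (L.Term ℕ × L.Term ℕ)} (hM : MemEqClass E M)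
    (hE : IsCongruenceDistributive.{u, v, w} E) (α β : Congruence L M) :
    commutator α β = α ⊓ β := by
  refine le_antisymm (commutator_le_inf α β) (le_iff.2 fun x y hxy => ?_)
  set δ := commutator α β
  -- Here `a = (x, x)`, `b = (x, y)`, `c = x`, `d = y`. The generators are `X = (x, x, x, x)`, `Z =
  -- (x, x, y, y)` and `Y = (x, y, x, y)`; the constant first entry is there to supply `X`.
  let v : Fin 4 → Fin 2 ⊕ Fin 1 → M :=
    ![Sum.elim ![x, x] ![x], Sum.elim ![x, x] ![y], Sum.elim ![x, y] ![x], Sum.elim ![x, y] ![y]]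
  let X : EvaluationAlgebra L v := gen v (.inl 0)
  let Y : EvaluationAlgebra L v := gen v (.inr 0)
  let Z : EvaluationAlgebra L v := gen v (.inl 1)
  have hδ : ∀ p : EvaluationAlgebra L v, p.1 0 = p.1 1 → δ.r (p.1 2) (p.1 3) := by
    rintro ⟨p, t, ht⟩ h
    change p 0 = p 1 at h
    change δ.r (p 2) (p 3)
    rw [ht, ht] at h ⊢
    refine (isLeast_commutator α β).1 2 1 t ![x, x] ![x, y] ![x] ![y] ?_ ?_ ?_
    · intro i
      fin_cases i
      exacts [α.iseqv.refl x, hxy.1]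
    · intro i
      fin_cases i
      exact hxy.2
    · change δ.r (t.realize (v 0)) (t.realize (v 1))
      rw [h]
  have hXZ : (ker (L := L) v {0, 1} ⊓ (ker v {2} ⊔ ker v {3})).r X Z := by
    refine ⟨?_, (ker v {2} ⊔ ker v {3}).iseqv.trans (y := Y)
      (le_iff.1 le_sup_left _ _ ?_) (le_iff.1 le_sup_right _ _ ?_)⟩
    · rintro i (rfl | rfl) <;> rfl
    · rintro i rfl
      rfl
    · rintro i rfl
      rfl
  rw [hE _ (memEqClass hM)] at hXZ
  have chain : ∀ q : EvaluationAlgebra L v,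
      ReflTransGen (fun p q => (ker v {0, 1} ⊓ ker v {2}).r p q ∨
        (ker v {0, 1} ⊓ ker v {3}).r p q) X q → q.1 0 = q.1 1 ∧ δ.r x (q.1 2) := by
    intro q hq
    induction hq with
    | refl => exact ⟨rfl, δ.iseqv.refl x⟩
    | @tail p q _ hpq ih =>
      have h01 : (ker v {0, 1}).r p q := hpq.elim And.left And.left
      have hq : q.1 0 = q.1 1 := by
        rw [← h01 0 (by simp), ← h01 1 (by simp)]
        exact ih.1
      refine ⟨hq, ?_⟩
      rcases hpq with h | h
      · rw [← h.2 2 rfl]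
        exact ih.2
      -- A step fixing coordinate 3 may move coordinate 2, but at both ends coordinates 2 and 3 are
      -- `δ`-related.
      · have h3 := hδ p ih.1
        rw [h.2 3 rfl] at h3
        exact δ.iseqv.trans ih.2 (δ.iseqv.trans h3 (δ.iseqv.symm (hδ q hq)))
  exact (chain Z (reflTransGen_of_sup hXZ)).2

/-- If commutators are intersections, then the congruence lattice is meet-semidistributive. -/
theorem sup_inf_le_of_commutator_eq_inf
    (hc : ∀ α β : Congruence L M, commutator α β = α ⊓ β) {α β γ δ : Congruence L M}
    (hα : α ⊓ β = δ) (hγ : γ ⊓ β = δ) : (α ⊔ γ) ⊓ β ≤ δ := by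
  have h₁ : Centralizes α β δ := by
    rw [← hα, ← hc]
    exact (isLeast_commutator α β).1
  have h₂ : Centralizes γ β δ := by
    rw [← hγ, ← hc]
    exact (isLeast_commutator γ β).1
  rw [← hc]
  exact (isLeast_commutator _ _).2 (centralizes_sup h₁ h₂)

/-- Semidistributivity needs two elements with the same meet with `β`; by modularity, `φ ⊓ β ⊔ α`
and `φ` are such a pair. -/
theorem sup_inf_sup_eq_of_inf_le [IsModularLattice (Congruence L M)]
    (hc : ∀ α β : Congruence L M, commutator α β = α ⊓ β) {α β φ : Congruence L M}
    (h : α ⊓ β ≤ φ) : (φ ⊔ α) ⊓ (φ ⊔ β) = φ := by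
  have h₁ : (φ ⊓ β ⊔ α) ⊓ β = φ ⊓ β := by
    rw [sup_inf_assoc_of_le α inf_le_right]
    exact sup_eq_left.2 (le_inf h inf_le_right)
  have h₂ : (φ ⊔ α) ⊓ β ≤ φ ⊓ β := by
    refine le_trans (inf_le_inf_right β ?_) (sup_inf_le_of_commutator_eq_inf hc h₁ rfl)
    exact sup_le le_sup_right (le_sup_right.trans le_sup_left)
  rw [inf_comm, sup_inf_assoc_of_le β le_sup_left, inf_comm β]
  exact sup_eq_left.2 (h₂.trans inf_le_left)

end Congruence

/-! ### Meet-irreducibility in lattices -/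

section Lattice

variable {K : Type w} [Lattice K] {x : K}

theorem StrictlyMeetIrreducible.meetIrreducible (h : StrictlyMeetIrreducible x) :
    MeetIrreducible x := by
  obtain ⟨y, hy, hmin⟩ := h
  intro a b hab
  by_contra! hne
  have ha : y ≤ a := hmin (lt_of_le_of_ne (hab.trans_le inf_le_left) hne.1)
  have hb : y ≤ b := hmin (lt_of_le_of_ne (hab.trans_le inf_le_right) hne.2)
  exact (lt_of_lt_of_le hy (le_inf ha hb)).ne hab

theorem StrictlyMeetIrreducible.ne_top [OrderTop K] (h : StrictlyMeetIrreducible x) :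
    x ≠ ⊤ := by
  obtain ⟨y, hy, -⟩ := h
  exact ne_top_of_lt hy

theorem MeetIrreducible.strictlyMeetIrreducible [OrderTop K] (h : MeetIrreducible x)
    (hx : x ≠ ⊤) (hfin : (Set.Ici x).Finite) : StrictlyMeetIrreducible x := by
  obtain ⟨y, hy⟩ := (hfin.subset Set.Ioi_subset_Ici_self).exists_minimal ⟨⊤, hx.lt_top⟩
  have hxy : x < y := hy.1
  refine ⟨y, hxy, fun z (hz : x < z) => ?_⟩
  -- Irreducibility keeps `y ⊓ z` strictly above `x`, so the minimal element `y` lies below every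
  -- such `z`.
  have hlt : x < y ⊓ z := lt_of_le_of_ne (le_inf hxy.le hz.le) fun he =>
    (h y z he).elim hxy.ne hz.ne
  exact (hy.2 hlt inf_le_left).trans inf_le_right

end Lattice

namespace Congruence

variable {L : FirstOrder.Language.{u, v}} {M : Type w} [L.Structure M] {φ : Congruence L M}

theorem IsPrime.meetIrreducible (h : φ.IsPrime) : MeetIrreducible φ := fun α β hφ =>
  (h.2 α β ((commutator_le_inf α β).trans_eq hφ.symm)).imp
    (le_antisymm (hφ.trans_le inf_le_left)) (le_antisymm (hφ.trans_le inf_le_right))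

theorem isPrime_of_strictlyMeetIrreducible [IsModularLattice (Congruence L M)]
    (hc : ∀ α β : Congruence L M, commutator α β = α ⊓ β)
    (h : StrictlyMeetIrreducible φ) : φ.IsPrime := by
  refine ⟨h.ne_top, fun α β hαβ => ?_⟩
  rw [hc] at hαβ
  exact (h.meetIrreducible _ _ (sup_inf_sup_eq_of_inf_le hc hαβ).symm).imp
    (fun he => left_eq_sup.1 he) fun he => left_eq_sup.1 he

end Congruence

theorem IsCongruenceDistributive.isCongruenceModular {L : FirstOrder.Language.{u, v}}
    {E : Set (L.Term ℕ × L.Term ℕ)} (h : IsCongruenceDistributive.{u, v, w} E) :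
    IsCongruenceModular.{u, v, w} E := fun M _ hM =>
  ⟨fun {α} β {γ} hαγ => by
    rw [inf_comm, h M hM, inf_comm γ α, inf_comm γ β]
    exact sup_le_sup_right inf_le_left _⟩

end UniversalAlgebra

theorem corollary3p5 {L : FirstOrder.Language.{u, v}} [L.IsAlgebraic]
    (E : Set (L.Term ℕ × L.Term ℕ)) (A : Type w) [L.Structure A]
    (hA : UniversalAlgebra.MemEqClass E A)
    (hE : UniversalAlgebra.IsCongruenceDistributive.{u, v, w} E ∨
      (UniversalAlgebra.IsCongruenceModular.{u, v, w} E ∧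
        ∀ α β : UniversalAlgebra.Congruence L A,
          UniversalAlgebra.Congruence.commutator α β = α ⊓ β))
    (φ : UniversalAlgebra.Congruence L A) :
    (UniversalAlgebra.StrictlyMeetIrreducible φ → φ.IsPrime) ∧
    (φ.IsPrime → φ ≠ ⊤ ∧ UniversalAlgebra.MeetIrreducible φ) ∧
    ((Set.Ici φ).Finite →
      (φ.IsPrime ↔ UniversalAlgebra.StrictlyMeetIrreducible φ) ∧
      (UniversalAlgebra.StrictlyMeetIrreducible φ ↔
        φ ≠ ⊤ ∧ UniversalAlgebra.MeetIrreducible φ)) ∧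
    (Finite (UniversalAlgebra.Congruence L A) →
      (φ.IsPrime ↔ UniversalAlgebra.StrictlyMeetIrreducible φ) ∧
      (UniversalAlgebra.StrictlyMeetIrreducible φ ↔
        φ ≠ ⊤ ∧ UniversalAlgebra.MeetIrreducible φ)) := by
  have hmod : IsModularLattice (UniversalAlgebra.Congruence L A) :=
    hE.elim (fun h => h.isCongruenceModular A hA) fun h => h.1 A hA
  have hc : ∀ α β : UniversalAlgebra.Congruence L A,
      UniversalAlgebra.Congruence.commutator α β = α ⊓ β :=
    hE.elim
      (UniversalAlgebra.Congruence.commutator_eq_inf_of_isCongruenceDistributive hA) And.right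
  have prime_of_strict : UniversalAlgebra.StrictlyMeetIrreducible φ → φ.IsPrime :=
    UniversalAlgebra.Congruence.isPrime_of_strictlyMeetIrreducible hc
  have irreducible_of_prime : φ.IsPrime → φ ≠ ⊤ ∧ UniversalAlgebra.MeetIrreducible φ :=
    fun h => ⟨h.1, h.meetIrreducible⟩
  have equivalences (hfin : (Set.Ici φ).Finite) :
      (φ.IsPrime ↔ UniversalAlgebra.StrictlyMeetIrreducible φ) ∧
      (UniversalAlgebra.StrictlyMeetIrreducible φ ↔
        φ ≠ ⊤ ∧ UniversalAlgebra.MeetIrreducible φ) := by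
    have strict_of_irreducible (h : φ ≠ ⊤ ∧ UniversalAlgebra.MeetIrreducible φ) :
        UniversalAlgebra.StrictlyMeetIrreducible φ :=
      h.2.strictlyMeetIrreducible h.1 hfin
    exact ⟨⟨strict_of_irreducible ∘ irreducible_of_prime, prime_of_strict⟩,
      ⟨irreducible_of_prime ∘ prime_of_strict, strict_of_irreducible⟩⟩
  exact ⟨prime_of_strict, irreducible_of_prime, equivalences,
    fun _ => equivalences (Set.toFinite _)⟩
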